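/- For $N\ge 1$ and a signature $\sigma=(\sigma_1,\ldots,\sigma_N)\in\{1,-1\}^N$ of length $N$, let $C(\sigma)$ denote the number of permutations $\pi$ of $\{1,2,\ldots,N+1\}$ such that $\mathrm{sign}(\pi(i+1)-\pi(i))=\sigma_i$ for all $1\le i\le N$. Let $p$ be an odd prime. For every signature $\sigma$ of length $N=p-1$, $$C(\sigma)\equiv \sigma_1\cdots\sigma_{p-1} \pmod p,$$ and in particular $C(\sigma)\equiv 1$ or $C(\sigma)\equiv -1 \pmod p$. For every signature $\sigma$ of length $N=p$, $$2\,C(\sigma)\equiv (\sigma_1+\sigma_p)\,\sigma_1\cdots\sigma_p \pmod p,$$ and therefore $C(\sigma)\equiv 0$, $1$ or $-1 \pmod p$. -/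

import Mathlib

/-- The up-down signature of a permutation of `N + 1` ordered letters (here the letters
`0, …, N`, in positions `0, …, N`): its `i`-th entry is the sign of `π (i + 1) - π i`. -/
def upDownSignature {N : ℕ} (π : Equiv.Perm (Fin (N + 1))) : Fin N → ℤ :=
  fun i => Int.sign (((π i.succ : ℕ) : ℤ) - ((π i.castSucc : ℕ) : ℤ))

/-- A signature of length `N`: a sequence of `N` signs `1` or `-1`. -/
def IsSignature {N : ℕ} (σ : Fin N → ℤ) : Prop :=
  ∀ i, σ i = 1 ∨ σ i = -1

/-- The up-down number `C(σ)`: the number of permutations of `N + 1` letters whose up-down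
signature is `σ`. -/
def upDownNumber {N : ℕ} (σ : Fin N → ℤ) : ℕ :=
  (Finset.univ.filter fun π : Equiv.Perm (Fin (N + 1)) => upDownSignature π = σ).card

/-! Let σ' be σ with entry `i` negated. Then C(σ) + C(σ') counts the permutations that obey σ except
perhaps at `i`: choose the letters for positions up to `i`, then arrange the two blocks
independently. So the sum is a multiple of `(N + 1).choose (i + 1)`. For N + 1 = p these binomials
vanish mod p, so C changes sign at every flip, as the product of signs does, and both are 1 at the
all-ones signature. For N = p the binomials vanish mod p except at the two end entries. There the
sum is (p + 1) C(τ), with τ the signature σ without that end entry, and the first case evaluates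
C(τ). -/

theorem upDownSignature_isSignature {N : ℕ} (π : Equiv.Perm (Fin (N + 1))) :
    IsSignature (upDownSignature π) := by
  intro i
  have h : ((π i.succ : ℕ) : ℤ) ≠ ((π i.castSucc : ℕ) : ℤ) := by
    intro h
    have := π.injective (Fin.ext (Int.ofNat.inj h))
    exact absurd this (Fin.castSucc_lt_succ).ne'
  rcases lt_or_gt_of_ne h with h | h
  · exact Or.inr (Int.sign_eq_neg_one_of_neg (by linarith))
  · exact Or.inl (Int.sign_eq_one_of_pos (by linarith))

theorem upDownSignature_eq_one_iff {N : ℕ} (π : Equiv.Perm (Fin (N + 1))) (i : Fin N) :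
    upDownSignature π i = 1 ↔ π i.castSucc < π i.succ := by
  rw [upDownSignature, Int.sign_eq_one_iff_pos, sub_pos, Fin.lt_def]
  exact Nat.cast_lt

/-- The signature obtained from `σ` by changing the sign of its `i`-th entry. -/
def flipSign {N : ℕ} (σ : Fin N → ℤ) (i : Fin N) : Fin N → ℤ :=
  Function.update σ i (-σ i)

theorem IsSignature.flipSign {N : ℕ} {σ : Fin N → ℤ} (h : IsSignature σ) (i : Fin N) :
    IsSignature (flipSign σ i) := by
  intro j
  have hi := h i
  have hj := h j
  by_cases hji : j = i
  · subst hji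
    simp only [_root_.flipSign, Function.update_self]
    omega
  · simpa [_root_.flipSign, hji] using hj

/-- The permutations whose signature agrees with `σ` except possibly at `i`. -/
def agreeingOff {N : ℕ} (σ : Fin N → ℤ) (i : Fin N) : Finset (Equiv.Perm (Fin (N + 1))) :=
  Finset.univ.filter fun π => ∀ j, j ≠ i → upDownSignature π j = σ j

theorem upDownNumber_add_flipSign {N : ℕ} {σ : Fin N → ℤ} (hσ : IsSignature σ) (i : Fin N) :
    upDownNumber σ + upDownNumber (flipSign σ i) = (agreeingOff σ i).card := by
  classical
  unfold upDownNumber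
  rw [← Finset.card_union_of_disjoint]
  · congr 1
    ext π
    simp only [agreeingOff, Finset.mem_union, Finset.mem_filter, Finset.mem_univ, true_and]
    constructor
    · rintro (h | h) j hj
      · rw [h]
      · rw [h, flipSign, Function.update_of_ne hj]
    · intro h
      have hi := hσ i
      have hs := upDownSignature_isSignature π i
      have : upDownSignature π i = σ i ∨ upDownSignature π i = -σ i := by omega
      refine this.imp (fun h' => ?_) (fun h' => ?_) <;> funext j <;> by_cases hj : j = i
      · rw [hj, h']
      · exact h j hj
      · rw [hj, h', flipSign, Function.update_self]
      · rw [h j hj, flipSign, Function.update_of_ne hj]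
  · rw [Finset.disjoint_filter]
    intro π _ h h'
    have := congrFun (h.symm.trans h') i
    rw [flipSign, Function.update_self] at this
    have := hσ i
    omega

/-- Two equinumerous sets of letters are matched by a permutation that preserves the order on the
first set and on its complement. -/
theorem exists_perm_strictMonoOn {n : ℕ} {A B : Finset (Fin n)} (h : A.card = B.card) :
    ∃ g : Equiv.Perm (Fin n), (∀ x, g x ∈ B ↔ x ∈ A) ∧
      ∀ x y, (x ∈ A ↔ y ∈ A) → (g x < g y ↔ x < y) := by
  have hc : Aᶜ.card = Bᶜ.card := by rw [Finset.card_compl, Finset.card_compl, h]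
  let e : A ≃o B := (A.orderIsoOfFin h).symm.trans (B.orderIsoOfFin rfl)
  let f : (Aᶜ : Finset (Fin n)) ≃o (Bᶜ : Finset (Fin n)) :=
    (Aᶜ.orderIsoOfFin hc).symm.trans (Bᶜ.orderIsoOfFin rfl)
  let f' : {x // ¬ x ∈ A} ≃ {x // ¬ x ∈ B} :=
    ((Equiv.subtypeEquivRight fun x => Finset.mem_compl.symm).trans f.toEquiv).trans
      (Equiv.subtypeEquivRight fun x => Finset.mem_compl)
  let g : Equiv.Perm (Fin n) := Equiv.subtypeCongr e.toEquiv f'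
  have hg₁ : ∀ x (hx : x ∈ A), g x = e ⟨x, hx⟩ := by
    intro x hx
    simp [g, Equiv.subtypeCongr, hx]
  have hg₂ : ∀ x (hx : x ∉ A), g x = f ⟨x, Finset.mem_compl.2 hx⟩ := by
    intro x hx
    simp [g, Equiv.subtypeCongr, hx]
    rfl
  refine ⟨g, fun x => ?_, fun x y hxy => ?_⟩
  · by_cases hx : x ∈ A
    · simp only [hx, iff_true, hg₁ x hx]
      exact (e ⟨x, hx⟩).2
    · simp only [hx, iff_false, hg₂ x hx]
      exact Finset.mem_compl.1 (f ⟨x, Finset.mem_compl.2 hx⟩).2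
  · by_cases hx : x ∈ A
    · have hy := hxy.1 hx
      rw [hg₁ x hx, hg₁ y hy, Subtype.coe_lt_coe, e.lt_iff_lt, Subtype.mk_lt_mk]
    · have hy : y ∉ A := fun hy => hx (hxy.2 hy)
      rw [hg₂ x hx, hg₂ y hy, Subtype.coe_lt_coe, f.lt_iff_lt, Subtype.mk_lt_mk]

/-- The set of letters that a permutation puts into the positions up to `i`. -/
def initialImage {N : ℕ} (i : Fin N) (π : Equiv.Perm (Fin (N + 1))) : Finset (Fin (N + 1)) :=
  (Finset.Iic i.castSucc).map π.toEmbedding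

theorem apply_mem_initialImage {N : ℕ} (i : Fin N) (π : Equiv.Perm (Fin (N + 1)))
    (x : Fin (N + 1)) : π x ∈ initialImage i π ↔ x ≤ i.castSucc := by
  simp [initialImage]

theorem card_initialImage {N : ℕ} (i : Fin N) (π : Equiv.Perm (Fin (N + 1))) :
    (initialImage i π).card = i + 1 := by
  simp [initialImage]

/-- Only the comparison at `i` involves one letter inside the initial block and one outside it, so
relabelling each block monotonically preserves all the others. -/
theorem mul_mem_agreeingOff {N : ℕ} {σ : Fin N → ℤ} {i : Fin N} {g π : Equiv.Perm (Fin (N + 1))}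
    (hg : ∀ x y, (x ∈ initialImage i π ↔ y ∈ initialImage i π) → (g x < g y ↔ x < y))
    (hπ : π ∈ agreeingOff σ i) : g * π ∈ agreeingOff σ i := by
  simp only [agreeingOff, Finset.mem_filter, Finset.mem_univ, true_and] at hπ ⊢
  intro j hj
  rw [← hπ j hj]
  have key : upDownSignature (g * π) j = 1 ↔ upDownSignature π j = 1 := by
    rw [upDownSignature_eq_one_iff, upDownSignature_eq_one_iff]
    refine hg _ _ ?_
    rw [apply_mem_initialImage, apply_mem_initialImage, Fin.le_def, Fin.le_def]
    have : (j : ℕ) ≠ i := fun h => hj (Fin.ext h)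
    simp only [Fin.val_castSucc, Fin.val_succ]
    omega
  have h₁ := upDownSignature_isSignature (g * π) j
  have h₂ := upDownSignature_isSignature π j
  omega

theorem card_filter_initialImage_le {N : ℕ} (σ : Fin N → ℤ) (i : Fin N)
    {A B : Finset (Fin (N + 1))} (h : A.card = B.card) :
    ((agreeingOff σ i).filter fun π => initialImage i π = A).card ≤
      ((agreeingOff σ i).filter fun π => initialImage i π = B).card := by
  obtain ⟨g, hgB, hg⟩ := exists_perm_strictMonoOn h
  refine Finset.card_le_card_of_injOn (fun π => g * π) ?_ (fun _ _ _ _ => mul_left_cancel)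
  intro π hπ
  rw [Finset.mem_coe, Finset.mem_filter] at hπ ⊢
  obtain ⟨hπ, rfl⟩ := hπ
  refine ⟨mul_mem_agreeingOff hg hπ, ?_⟩
  ext x
  obtain ⟨y, rfl⟩ := (g * π).surjective x
  rw [apply_mem_initialImage, Equiv.Perm.mul_apply, hgB, apply_mem_initialImage]

theorem card_agreeingOff {N : ℕ} (σ : Fin N → ℤ) (i : Fin N) {A : Finset (Fin (N + 1))}
    (hA : A.card = i + 1) :
    (agreeingOff σ i).card = (N + 1).choose (i + 1) *
      ((agreeingOff σ i).filter fun π => initialImage i π = A).card := by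
  rw [Finset.card_eq_sum_card_fiberwise (f := initialImage i)
    (t := Finset.univ.powersetCard (i + 1))]
  · rw [Finset.sum_congr rfl (g := fun _ =>
      ((agreeingOff σ i).filter fun π => initialImage i π = A).card)]
    · simp
    · intro B hB
      have hB := (Finset.mem_powersetCard.1 hB).2
      exact le_antisymm (card_filter_initialImage_le σ i (hB.trans hA.symm))
        (card_filter_initialImage_le σ i (hA.trans hB.symm))
  · intro π _
    simp [Finset.mem_powersetCard, card_initialImage]

theorem upDownNumber_add_flipSign_of_dvd_choose {p N : ℕ} {σ : Fin N → ℤ} (hσ : IsSignature σ)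
    (i : Fin N) (h : p ∣ (N + 1).choose (i + 1)) :
    (upDownNumber (flipSign σ i) : ZMod p) = -upDownNumber σ := by
  rw [eq_neg_iff_add_eq_zero, add_comm, ← Nat.cast_add, upDownNumber_add_flipSign hσ,
    card_agreeingOff σ i (card_initialImage i 1), Nat.cast_mul,
    (ZMod.natCast_eq_zero_iff _ _).2 h, zero_mul]

/-! ### Flipping the first entry; reversal; the increasing permutation -/

theorem upDownSignature_decomposeFin_symm_zero {N : ℕ} (e : Equiv.Perm (Fin (N + 1)))
    (j : Fin N) :
    upDownSignature (Equiv.Perm.decomposeFin.symm (0, e)) j.succ = upDownSignature e j := by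
  simp [upDownSignature, Fin.castSucc_succ, Equiv.Perm.decomposeFin_symm_apply_succ]

theorem upDownNumber_add_flipSign_zero {N : ℕ} {σ : Fin (N + 1) → ℤ} (hσ : IsSignature σ) :
    upDownNumber σ + upDownNumber (flipSign σ 0) = (N + 2) * upDownNumber (Fin.tail σ) := by
  -- All fibres have equal size; the one with first letter 0 is counted by deleting that letter.
  rw [upDownNumber_add_flipSign hσ, card_agreeingOff σ 0 (A := {0}) (by simp)]
  congr 1
  · simp
  · symm
    refine Finset.card_bij (fun e _ => Equiv.Perm.decomposeFin.symm (0, e)) ?_ ?_ ?_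
    · intro e he
      have he : upDownSignature e = Fin.tail σ := by simpa using he
      simp only [agreeingOff, Finset.mem_filter, Finset.mem_univ, true_and]
      constructor
      · intro j hj
        obtain ⟨j, rfl⟩ := Fin.exists_succ_eq.2 hj
        rw [upDownSignature_decomposeFin_symm_zero, he, Fin.tail]
      · have h0 : Equiv.Perm.decomposeFin.symm (0, e) 0 = 0 := by simp
        ext x
        obtain ⟨x, rfl⟩ := (Equiv.Perm.decomposeFin.symm (0, e)).surjective x
        rw [apply_mem_initialImage, Fin.castSucc_zero, Fin.le_zero_iff, Finset.mem_singleton]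
        nth_rw 3 [← h0]
        rw [EmbeddingLike.apply_eq_iff_eq]
    · intro e _ e' _ h
      simpa using h
    · intro π hπ
      simp only [agreeingOff, Finset.mem_filter, Finset.mem_univ, true_and] at hπ
      have h0 : π 0 = 0 := by
        have := (apply_mem_initialImage 0 π 0).2 (Fin.zero_le _)
        rwa [hπ.2, Finset.mem_singleton] at this
      obtain ⟨⟨q, e⟩, rfl⟩ := Equiv.Perm.decomposeFin.symm.surjective π
      obtain rfl : q = 0 := by simpa using h0
      refine ⟨e, ?_, rfl⟩
      simp only [Finset.mem_filter, Finset.mem_univ, true_and]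
      funext j
      rw [← upDownSignature_decomposeFin_symm_zero, hπ.1 _ (Fin.succ_ne_zero j), Fin.tail]

/-- Reversing positions and reversing letters each negate the signs, so together they only reverse
their order. -/
theorem upDownSignature_conj_rev {N : ℕ} (π : Equiv.Perm (Fin (N + 1))) (i : Fin N) :
    upDownSignature (Fin.revPerm * π * Fin.revPerm) i = upDownSignature π i.rev := by
  simp only [upDownSignature, Equiv.Perm.mul_apply, Fin.revPerm_apply, Fin.rev_succ,
    Fin.rev_castSucc, Fin.val_rev]
  congr 1
  have h₁ := (π i.rev.succ).isLt
  have h₂ := (π i.rev.castSucc).isLt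
  omega

theorem upDownNumber_comp_rev {N : ℕ} (σ : Fin N → ℤ) :
    upDownNumber (σ ∘ Fin.rev) = upDownNumber σ := by
  have hle : ∀ τ : Fin N → ℤ, upDownNumber τ ≤ upDownNumber (τ ∘ Fin.rev) := by
    intro τ
    refine Finset.card_le_card_of_injOn (fun π => Fin.revPerm * π * Fin.revPerm) ?_ ?_
    · intro π hπ
      have hπ : upDownSignature π = τ := by simpa using hπ
      simp only [Finset.coe_filter, Finset.mem_univ, true_and, Set.mem_ofPred_eq]
      funext j
      rw [upDownSignature_conj_rev, hπ, Function.comp_apply]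
    · intro π _ π' _ h
      simpa using h
  refine le_antisymm ((hle _).trans_eq ?_) (hle σ)
  congr 1
  funext j
  simp

theorem upDownNumber_one {N : ℕ} : upDownNumber (fun _ : Fin N => 1) = 1 := by
  rw [upDownNumber, Finset.card_eq_one]
  refine ⟨1, ?_⟩
  ext π
  simp only [Finset.mem_filter, Finset.mem_univ, true_and, Finset.mem_singleton, funext_iff,
    upDownSignature_eq_one_iff]
  constructor
  · intro h
    have hm : StrictMono π := Fin.strictMono_iff_lt_succ.2 h
    have := Subsingleton.elim (hm.orderIsoOfSurjective π π.surjective) (OrderIso.refl _)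
    ext x
    exact congrArg Fin.val (DFunLike.congr_fun this x)
  · rintro rfl j
    exact Fin.castSucc_lt_succ

/-! ### The congruences modulo p -/

/-- Induction on the number of entries other than 1, flipping one of them. It is applied to the
difference of the two sides of each congruence. -/
theorem eq_zero_of_flipSign_eq_neg {R : Type*} [Ring R] {N : ℕ} {g : (Fin N → ℤ) → R}
    (hflip : ∀ σ, IsSignature σ → ∀ i, g (flipSign σ i) = -g σ) (hone : g (fun _ => 1) = 0)
    {σ : Fin N → ℤ} (hσ : IsSignature σ) : g σ = 0 := by
  induction hk : (Finset.univ.filter fun i => σ i ≠ 1).card using Nat.strong_induction_on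
    generalizing σ with
  | _ k ih =>
    by_cases hall : ∀ i, σ i = 1
    · rwa [show σ = fun _ => 1 from funext hall]
    · push Not at hall
      obtain ⟨i, hi⟩ := hall
      have hlt : (Finset.univ.filter fun j => flipSign σ i j ≠ 1).card < k := by
        rw [← hk]
        refine Finset.card_lt_card (Finset.ssubset_iff_of_subset ?_ |>.2 ⟨i, ?_, ?_⟩)
        · intro j hj
          rw [Finset.mem_filter] at hj ⊢
          refine ⟨hj.1, ?_⟩
          by_cases hji : j = i
          · rwa [hji]
          · simpa [flipSign, hji] using hj.2
        · simpa using hi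
        · have := (hσ i).resolve_left hi
          simp [flipSign, this]
      have := ih _ hlt (hσ.flipSign i) rfl
      rwa [hflip σ hσ i, neg_eq_zero] at this

theorem prod_flipSign {N : ℕ} (σ : Fin N → ℤ) (i : Fin N) :
    ∏ j, flipSign σ i j = -∏ j, σ j := by
  rw [flipSign, Finset.prod_update_of_mem (Finset.mem_univ i),
    ← Finset.mul_prod_erase _ σ (Finset.mem_univ i), neg_mul, Finset.sdiff_singleton_eq_erase]

theorem upDownNumber_eq_prod {p N : ℕ} (hp : p.Prime) (hN : N + 1 = p) {σ : Fin N → ℤ}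
    (hσ : IsSignature σ) : (upDownNumber σ : ZMod p) = ((∏ i, σ i : ℤ) : ZMod p) := by
  rw [← sub_eq_zero]
  refine eq_zero_of_flipSign_eq_neg
    (g := fun τ => (upDownNumber τ : ZMod p) - ((∏ i, τ i : ℤ) : ZMod p)) ?_ ?_ hσ
  · intro τ hτ i
    rw [upDownNumber_add_flipSign_of_dvd_choose hτ i, prod_flipSign, Int.cast_neg]
    · ring
    · rw [hN]
      exact hp.dvd_choose_self (by omega) (by omega)
  · simp [upDownNumber_one]

theorem upDownNumber_add_flipSign_zero_eq {p N : ℕ} (hp : p.Prime) (hN : N + 1 = p)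
    {σ : Fin (N + 1) → ℤ} (hσ : IsSignature σ) :
    (upDownNumber σ + upDownNumber (flipSign σ 0) : ZMod p) =
      ((σ 0 * ∏ i, σ i : ℤ) : ZMod p) := by
  have hsq : σ 0 * σ 0 = 1 := by rcases hσ 0 with h | h <;> simp [h]
  have hp0 : ((N + 2 : ℕ) : ZMod p) = 1 := by
    rw [show N + 2 = p + 1 by omega]
    simp
  rw [← Nat.cast_add, upDownNumber_add_flipSign_zero hσ, Nat.cast_mul, hp0, one_mul,
    upDownNumber_eq_prod hp hN (σ := Fin.tail σ) (fun i => hσ i.succ), Fin.prod_univ_succ, ← mul_assoc, hsq, one_mul]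
  rfl

theorem flipSign_last_comp_rev {N : ℕ} (σ : Fin (N + 1) → ℤ) :
    flipSign σ (Fin.last N) ∘ Fin.rev = flipSign (σ ∘ Fin.rev) 0 := by
  funext j
  by_cases hj : j = 0
  · simp [hj, flipSign]
  · have : j.rev ≠ Fin.last N := by rwa [ne_eq, Fin.rev_eq_iff, Fin.rev_last]
    simp [flipSign, hj, this]

theorem upDownNumber_add_flipSign_last_eq {p N : ℕ} (hp : p.Prime) (hN : N + 1 = p)
    {σ : Fin (N + 1) → ℤ} (hσ : IsSignature σ) :
    (upDownNumber σ + upDownNumber (flipSign σ (Fin.last N)) : ZMod p) =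
      ((σ (Fin.last N) * ∏ i, σ i : ℤ) : ZMod p) := by
  rw [← upDownNumber_comp_rev σ, ← upDownNumber_comp_rev (flipSign _ _), flipSign_last_comp_rev,
    upDownNumber_add_flipSign_zero_eq hp hN (σ := σ ∘ Fin.rev) (fun i => hσ i.rev)]
  simp only [Function.comp_apply, Fin.rev_zero]
  rw [Equiv.prod_comp Fin.revPerm σ |>.symm]
  rfl

theorem dvd_choose_succ_self {p k : ℕ} (hp : p.Prime) (h₂ : 2 ≤ k) (hk : k < p) :
    p ∣ (p + 1).choose k := by
  obtain ⟨k, rfl⟩ := Nat.exists_eq_add_of_le' (show 1 ≤ k by omega)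
  rw [Nat.choose_succ_succ]
  exact dvd_add (hp.dvd_choose_self (by omega) (by omega))
    (hp.dvd_choose_self (by omega) (by omega))

theorem two_mul_upDownNumber_eq {p N : ℕ} (hp : p.Prime) (hodd : Odd p) (hN : N + 1 = p)
    {σ : Fin (N + 1) → ℤ} (hσ : IsSignature σ) :
    (2 * upDownNumber σ : ZMod p) =
      (((σ 0 + σ (Fin.last N)) * ∏ i, σ i : ℤ) : ZMod p) := by
  have hne : (0 : Fin (N + 1)) ≠ Fin.last N := by
    have := hp.two_le
    obtain ⟨m, hm⟩ := hodd
    rw [ne_eq, Fin.ext_iff, Fin.val_zero, Fin.val_last]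
    omega
  rw [← sub_eq_zero]
  refine eq_zero_of_flipSign_eq_neg (g := fun τ => (2 * upDownNumber τ : ZMod p) -
    (((τ 0 + τ (Fin.last N)) * ∏ i, τ i : ℤ) : ZMod p)) ?_ ?_ hσ
  · intro τ hτ i
    rw [prod_flipSign]
    by_cases h0 : i = 0
    · subst h0
      have h := upDownNumber_add_flipSign_zero_eq hp hN hτ
      have e₁ : flipSign τ 0 0 = -τ 0 := Function.update_self ..
      have e₂ : flipSign τ 0 (Fin.last N) = τ (Fin.last N) := Function.update_of_ne hne.symm _ _
      rw [e₁, e₂]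
      push_cast at h ⊢
      -- Flipping an end negates both its summand and the product, so the two right-hand sides add
      -- up to twice that end sign times the product.
      linear_combination 2 * h
    by_cases hl : i = Fin.last N
    · subst hl
      have h := upDownNumber_add_flipSign_last_eq hp hN hτ
      have e₁ : flipSign τ (Fin.last N) (Fin.last N) = -τ (Fin.last N) := Function.update_self ..
      have e₂ : flipSign τ (Fin.last N) 0 = τ 0 := Function.update_of_ne hne _ _
      rw [e₁, e₂]
      push_cast at h ⊢
      linear_combination 2 * h
    · have e₁ : flipSign τ i 0 = τ 0 := Function.update_of_ne (Ne.symm h0) _ _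
      have e₂ : flipSign τ i (Fin.last N) = τ (Fin.last N) :=
        Function.update_of_ne (Ne.symm hl) _ _
      rw [e₁, e₂, upDownNumber_add_flipSign_of_dvd_choose hτ i]
      · push_cast
        ring
      · have h0 : (i : ℕ) ≠ 0 := fun h => h0 (Fin.ext h)
        have hl : (i : ℕ) ≠ N := fun h => hl (Fin.ext h)
        have := i.isLt
        simpa only [hN] using dvd_choose_succ_self (k := i + 1) hp (by omega) (by omega)
  · norm_num [upDownNumber_one]

theorem IsSignature.prod_eq {N : ℕ} {σ : Fin N → ℤ} (hσ : IsSignature σ) :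
    ∏ i, σ i = 1 ∨ ∏ i, σ i = -1 := by
  rw [← Int.isUnit_iff, IsUnit.prod_univ_iff]
  exact fun i => Int.isUnit_iff.2 (hσ i)

theorem corollary3 (p : ℕ) (hp : p.Prime) (hodd : Odd p) :
    (∀ σ : Fin (p - 1) → ℤ, IsSignature σ →
      (upDownNumber σ : ℤ) ≡ ∏ i, σ i [ZMOD p] ∧
      ((upDownNumber σ : ℤ) ≡ 1 [ZMOD p] ∨ (upDownNumber σ : ℤ) ≡ -1 [ZMOD p])) ∧
    (∀ σ : Fin p → ℤ, IsSignature σ →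
      2 * (upDownNumber σ : ℤ) ≡
        (σ ⟨0, hp.pos⟩ + σ ⟨p - 1, Nat.sub_one_lt hp.ne_zero⟩) * ∏ i, σ i [ZMOD p] ∧
      ((upDownNumber σ : ℤ) ≡ 0 [ZMOD p] ∨ (upDownNumber σ : ℤ) ≡ 1 [ZMOD p] ∨
        (upDownNumber σ : ℤ) ≡ -1 [ZMOD p])) := by
  constructor
  · intro σ hσ
    have h : (upDownNumber σ : ℤ) ≡ ∏ i, σ i [ZMOD p] := by
      rw [← ZMod.intCast_eq_intCast_iff, Int.cast_natCast]
      exact upDownNumber_eq_prod hp (Nat.sub_add_cancel hp.one_le) hσ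
    refine ⟨h, ?_⟩
    rcases hσ.prod_eq with hs | hs <;> rw [hs] at h
    · exact Or.inl h
    · exact Or.inr h
  · intro σ hσ
    obtain ⟨N, hN⟩ := Nat.exists_eq_add_of_le' hp.one_le
    subst hN
    have h : 2 * (upDownNumber σ : ℤ) ≡
        (σ 0 + σ (Fin.last N)) * ∏ i, σ i [ZMOD ((N + 1 : ℕ) : ℤ)] := by
      rw [← ZMod.intCast_eq_intCast_iff]
      have := two_mul_upDownNumber_eq hp hodd rfl hσ
      push_cast at this ⊢
      exact this
    refine ⟨h, ?_⟩
    have hcancel : ∀ c : ℤ, 2 * (upDownNumber σ : ℤ) ≡ 2 * c [ZMOD ((N + 1 : ℕ) : ℤ)] →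
        (upDownNumber σ : ℤ) ≡ c [ZMOD ((N + 1 : ℕ) : ℤ)] := by
      intro c hc
      rw [Int.modEq_iff_dvd, ← mul_sub] at hc
      -- The factor 2 cancels because the modulus is odd.
      refine Int.modEq_iff_dvd.2 (IsCoprime.dvd_of_dvd_mul_left ?_ hc)
      exact Nat.isCoprime_iff_coprime.2 (Nat.coprime_two_right.2 hodd)
    rcases hσ 0 with h0 | h0 <;> rcases hσ (Fin.last N) with hl | hl <;>
      rcases hσ.prod_eq with hs | hs <;> rw [h0, hl, hs] at h
    · exact Or.inr (Or.inl (hcancel 1 h))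
    · exact Or.inr (Or.inr (hcancel (-1) h))
    · exact Or.inl (hcancel 0 h)
    · exact Or.inl (hcancel 0 h)
    · exact Or.inl (hcancel 0 h)
    · exact Or.inl (hcancel 0 h)
    · exact Or.inr (Or.inr (hcancel (-1) h))
    · exact Or.inr (Or.inl (hcancel 1 h))
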